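/- **Setting.** Let $D\ge 1$ and $n\ge 0$ be integers, and let $\mathcal H_n=(\mathbb C^D)^{\otimes n}$ be the Hilbert space of $n$ carrier qudits of dimension $D$ ($D$ need not be prime). Put $\omega=e^{2\pi i/D}$, $Z=\sum_j\omega^j|j\rangle\langle j|$, $X=\sum_j|j\rangle\langle j+1|$ (integers mod $D$). The Pauli group $\mathcal P_n$ consists of the Pauli products $\omega^{\lambda}X^{\mathbf x}Z^{\mathbf z}=\omega^\lambda X_1^{x_1}Z_1^{z_1}\otimes\cdots\otimes X_n^{x_n}Z_n^{z_n}$ with $\lambda\in\mathbb Z_D$ and $\mathbf x,\mathbf z\in\mathbb Z_D^n$. Let $G$ be an undirected loopless graph on the $n$ qudits with edge multiplicities $\Gamma_{ab}=\Gamma_{ba}\in\{0,\dots,D-1\}$. Its graph state is $|G\rangle=\prod_{a<b}\mathrm{CP}_{ab}^{\Gamma_{ab}}\,|+\rangle^{\otimes n}$, where $|+\rangle=D^{-1/2}\sum_j|j\rangle$ and $\mathrm{CP}_{ab}=\sum_{j,k}\omega^{jk}|j\rangle\langle j|_a\otimes|k\rangle\langle k|_b$. Let $C\le\mathbb Z_D^n$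 be a subgroup, of order $K$, and let $\mathcal C=\{Z^{\mathbf c}:\mathbf c\in C\}$ be the coding group. The additive graph code is the space $\mathcal H_C$ spanned by the codewords $Z^{\mathbf c}|G\rangle$, $\mathbf c\in C$; let $P$ be the orthogonal projector onto $\mathcal H_C$. Let $\mathcal S\le\mathcal P_n$ be the subgroup of Pauli products that fix every codeword, $\mathcal S^G\le\mathcal P_n$ the subgroup of those that fix $|G\rangle$, and $\mathcal W=\langle\mathcal S^G,\mathcal C\rangle$. The information group is the set of operators $$\mathcal G=\Big\{\hat g=|\mathcal S|^{-1}\sum_{s\in\mathcal S}gs\;:\;g\in\mathcal W\Big\}$$ under operator multiplication. Let $B$ be a subset of the carriers with complement $B^c$. An operator is *based in $B$* if it has the form $A\otimes I_{B^c}$ with $A$ an operator on $\mathcal H_B$; let $\mathcal B$ be the set of these operators. Put $$N=\frac{|\mathcal S\cap\mathcal B|\,D^{|B^c|}}{|\mathcal S|},\qquad g_B=N^{-1}\operatorname{Tr}_{B^c}[\hat g],$$ $$\mathcal G^B=\{\hat g\in\mathcal G:\operatorname{Tr}_{B^c}[\hat g]\ne0\},\qquad \mathcal G_B=\{g_B:\hat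 g\in\mathcal G,\ g_B\neq 0\}.$$ **Theorem (Isomorphism theorem).** We have $\dim\mathcal H_C=K$ and $N>0$. The set $\mathcal G$ is a group under operator multiplication with identity element $P$. The set $\mathcal G^B$ is a subgroup of $\mathcal G$. The set $\mathcal G_B$ of nonzero operators on $\mathcal H_B$ is a group under operator multiplication, with identity element $P_B:=N^{-1}\operatorname{Tr}_{B^c}[P]$, and $\hat g\mapsto g_B$ is a group isomorphism from $\mathcal G^B$ onto $\mathcal G_B$. Moreover: 1. For all $\hat g,\hat h\in\mathcal G^B$, $\operatorname{Tr}_{B^c}[\hat g\hat h]=\operatorname{Tr}_{B^c}[\hat g]\operatorname{Tr}_{B^c}[\hat h]/N$; equivalently, $(gh)_B=g_Bh_B$. 2. If $\hat g\ne\hat h$ are distinct elements of $\mathcal G^B$, then $g_B\ne h_B$. 3. $P_B$ is an orthogonal projector onto a subspace of $\mathcal H_B$ (possibly the whole space), of rank $\operatorname{Tr}[P]/N=K/N$. -/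

import Mathlib

open scoped Matrix Kronecker

namespace AdditiveGraphCode

noncomputable section

/-- Labels `|j₁, …, jₙ⟩` of the computational basis of `n` qudits of dimension `D`. -/
abbrev Idx (D n : ℕ) : Type := Fin n → ZMod D

/-- Operators on the Hilbert space of `n` qudits, as matrices in the computational basis. -/
abbrev Op (D n : ℕ) : Type := Matrix (Idx D n) (Idx D n) ℂ

/-- The group of unitary operators on `n` qudits. -/
abbrev UOp (D n : ℕ) [NeZero D] : Type := ↥(Matrix.unitaryGroup (Idx D n) ℂ)

/-! ### Pauli products -/

/-- `ω ^ j` for `ω = exp (2 π i / D)` and `j` an integer mod `D`. -/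
def omegaPow {D : ℕ} [NeZero D] (j : ZMod D) : ℂ := ZMod.stdAddChar j

/-- `Z = ∑ⱼ ω ^ j |j⟩⟨j|`. -/
def qZ (D : ℕ) [NeZero D] : Matrix (ZMod D) (ZMod D) ℂ := Matrix.diagonal fun j => omegaPow j

/-- `X = ∑ⱼ |j⟩⟨j + 1|`. -/
def qX (D : ℕ) [NeZero D] : Matrix (ZMod D) (ZMod D) ℂ :=
  Matrix.of fun j k => if k = j + 1 then 1 else 0

/-- The tensor product `M₁ ⊗ ⋯ ⊗ Mₙ` of one-qudit operators. -/
def tensorOp {D n : ℕ} (M : Fin n → Matrix (ZMod D) (ZMod D) ℂ) : Op D n :=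
  Matrix.of fun j k => ∏ v, M v (j v) (k v)

/-- The Pauli product `ω ^ l X₁^{x₁} Z₁^{z₁} ⊗ ⋯ ⊗ Xₙ^{xₙ} Zₙ^{zₙ}`. -/
def pauliProduct {D n : ℕ} [NeZero D] (l : ZMod D) (x z : Idx D n) : Op D n :=
  omegaPow l • tensorOp fun v => qX D ^ (x v).val * qZ D ^ (z v).val

theorem omegaPow_zero {D : ℕ} [NeZero D] : omegaPow (0 : ZMod D) = 1 := by
  simp [omegaPow]

theorem omegaPow_add {D : ℕ} [NeZero D] (a b : ZMod D) :
    omegaPow (a + b) = omegaPow a * omegaPow b := by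
  simp [omegaPow, AddChar.map_add_eq_mul]

theorem omegaPow_sum {D : ℕ} [NeZero D] {ι : Type*} (s : Finset ι) (f : ι → ZMod D) :
    omegaPow (∑ i ∈ s, f i) = ∏ i ∈ s, omegaPow (f i) := by
  classical
  induction s using Finset.induction_on with
  | empty => simp [omegaPow]
  | insert a s ha ih => rw [Finset.sum_insert ha, Finset.prod_insert ha, omegaPow_add, ih]

theorem star_omegaPow {D : ℕ} [NeZero D] (a : ZMod D) : star (omegaPow a) = omegaPow (-a) := by
  simp only [omegaPow]
  exact (AddChar.map_neg_eq_conj _ a).symm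

theorem omegaPow_pow {D : ℕ} [NeZero D] (a : ZMod D) (m : ℕ) :
    omegaPow a ^ m = omegaPow (a * (m : ZMod D)) := by
  simp only [omegaPow]
  rw [← AddChar.map_nsmul_eq_pow, nsmul_eq_mul, mul_comm]

/-- `omegaPow` is the power function of `ω = exp (2 π i / D)`. -/
theorem omegaPow_natCast {D : ℕ} [NeZero D] (m : ℕ) :
    omegaPow (m : ZMod D) = Complex.exp (2 * Real.pi * Complex.I / D) ^ m := by
  have h := ZMod.stdAddChar_coe (N := D) (m : ℤ)
  rw [Int.cast_natCast] at h
  rw [omegaPow, h, ← Complex.exp_nat_mul]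
  congr 1
  push_cast
  ring

theorem qX_pow_apply {D : ℕ} [NeZero D] (m : ℕ) (j k : ZMod D) :
    (qX D ^ m) j k = if k = j + m then 1 else 0 := by
  induction m generalizing k with
  | zero => simp [Matrix.one_apply, eq_comm]
  | succ m ih =>
    rw [pow_succ, Matrix.mul_apply, Finset.sum_eq_single (j + m)]
    · rw [ih, if_pos rfl, one_mul]
      simp [qX, add_assoc]
    · intro b _ hb
      simp [ih, hb]
    · simp

/-- The matrix entries of a Pauli product. -/
theorem pauliProduct_apply {D n : ℕ} [NeZero D] (l : ZMod D) (x z j k : Idx D n) :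
    pauliProduct l x z j k = if k = j + x then omegaPow (l + ∑ v, k v * z v) else 0 := by
  have h : ∀ v, (qX D ^ (x v).val * qZ D ^ (z v).val) (j v) (k v) =
      if k v = j v + x v then omegaPow (k v * z v) else 0 := by
    intro v
    rw [qZ, Matrix.diagonal_pow, Matrix.mul_diagonal, qX_pow_apply]
    simp [omegaPow_pow]
  simp only [pauliProduct, tensorOp, Matrix.smul_apply, Matrix.of_apply, h, smul_eq_mul]
  split_ifs with hk
  · subst hk
    simp [omegaPow_add, omegaPow_sum]
  · obtain ⟨v, hv⟩ := Function.ne_iff.1 hk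
    rw [Finset.prod_eq_zero (Finset.mem_univ v) (if_neg hv), mul_zero]

theorem pauliProduct_zero {D n : ℕ} [NeZero D] :
    pauliProduct (0 : ZMod D) (0 : Idx D n) 0 = 1 := by
  ext j k
  simp [pauliProduct_apply, Matrix.one_apply, omegaPow_zero, eq_comm]

theorem pauliProduct_mul {D n : ℕ} [NeZero D] (l l' : ZMod D) (x z x' z' : Idx D n) :
    pauliProduct l x z * pauliProduct l' x' z' =
      pauliProduct (l + l' - ∑ v, x' v * z v) (x + x') (z + z') := by
  ext j k
  rw [Matrix.mul_apply, Finset.sum_eq_single (j + x)]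
  · simp only [pauliProduct_apply, if_true, mul_ite, mul_zero, add_assoc]
    split_ifs with hk
    · subst hk
      rw [← omegaPow_add]
      congr 1
      simp only [Pi.add_apply, mul_add, add_mul, Finset.sum_add_distrib]
      ring
    · rfl
  · intro b _ hb
    simp [pauliProduct_apply, hb]
  · simp

theorem star_pauliProduct {D n : ℕ} [NeZero D] (l : ZMod D) (x z : Idx D n) :
    star (pauliProduct l x z) = pauliProduct (-l - ∑ v, x v * z v) (-x) (-z) := by
  ext j k
  rw [Matrix.star_apply, pauliProduct_apply, pauliProduct_apply]
  have : j = k + x ↔ k = j + -x := by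
    constructor <;> rintro rfl <;> simp
  by_cases h : k = j + -x
  · rw [if_pos (this.2 h), if_pos h, star_omegaPow]
    congr 1
    subst h
    simp only [Pi.add_apply, Pi.neg_apply, mul_neg, add_mul, neg_mul, Finset.sum_neg_distrib,
      Finset.sum_add_distrib]
    ring
  · rw [if_neg (fun h' => h (this.1 h')), if_neg h, star_zero]

theorem pauliProduct_mem_unitary {D n : ℕ} [NeZero D] (l : ZMod D) (x z : Idx D n) :
    pauliProduct l x z ∈ Matrix.unitaryGroup (Idx D n) ℂ := by
  rw [Matrix.mem_unitaryGroup_iff, star_pauliProduct, pauliProduct_mul]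
  convert pauliProduct_zero (D := D) (n := n) using 2
  · simp only [Pi.neg_apply, neg_mul, Finset.sum_neg_distrib]
    ring
  · simp
  · simp

/-- A Pauli product as an element of the unitary group. -/
def pauliUnitary {D n : ℕ} [NeZero D] (l : ZMod D) (x z : Idx D n) : UOp D n :=
  ⟨pauliProduct l x z, pauliProduct_mem_unitary l x z⟩

/-- The Pauli group of `n` qudits: all the Pauli products. -/
def pauliGroup (D n : ℕ) [NeZero D] : Subgroup (UOp D n) where
  carrier := {u | ∃ l x z, u = pauliUnitary l x z}
  one_mem' := ⟨0, 0, 0, Subtype.ext pauliProduct_zero.symm⟩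
  mul_mem' := by
    rintro _ _ ⟨l, x, z, rfl⟩ ⟨l', x', z', rfl⟩
    exact ⟨_, _, _, Subtype.ext (pauliProduct_mul l l' x z x' z')⟩
  inv_mem' := by
    rintro _ ⟨l, x, z, rfl⟩
    exact ⟨_, _, _, Subtype.ext (star_pauliProduct l x z)⟩

instance {D n : ℕ} [NeZero D] : Finite (pauliGroup D n) := by
  have : Set.Finite (pauliGroup D n : Set (UOp D n)) := by
    refine (Set.finite_range
      fun p : ZMod D × Idx D n × Idx D n => pauliUnitary p.1 p.2.1 p.2.2).subset ?_
    rintro _ ⟨l, x, z, rfl⟩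
    exact ⟨(l, x, z), rfl⟩
  exact this.to_subtype

/-- The (pointwise) stabilizer of a set of vectors in the Pauli group. -/
def pauliStabilizer {D n : ℕ} [NeZero D] (T : Set (Idx D n → ℂ)) : Subgroup (UOp D n) where
  carrier := {u | u ∈ pauliGroup D n ∧ ∀ v ∈ T, (u : Op D n) *ᵥ v = v}
  one_mem' := ⟨one_mem _, by simp⟩
  mul_mem' := by
    rintro a b ⟨ha, ha'⟩ ⟨hb, hb'⟩
    refine ⟨mul_mem ha hb, fun v hv => ?_⟩
    rw [Submonoid.coe_mul, ← Matrix.mulVec_mulVec, hb' v hv, ha' v hv]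
  inv_mem' := by
    rintro a ⟨ha, ha'⟩
    refine ⟨inv_mem ha, fun v hv => ?_⟩
    conv_lhs => rw [← ha' v hv]
    rw [Matrix.mulVec_mulVec, ← Submonoid.coe_mul, inv_mul_cancel]
    simp

instance {D n : ℕ} [NeZero D] (T : Set (Idx D n → ℂ)) : Finite (pauliStabilizer T) :=
  Finite.of_injective
    (fun u : pauliStabilizer T => (⟨u.1, u.2.1⟩ : pauliGroup D n))
    fun _ _ h => Subtype.ext (congrArg (fun w : pauliGroup D n => (w : UOp D n)) h)

/-! ### Graph states and additive graph codes -/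

/-- An undirected graph without loops on the `n` carrier qudits; `mult a b` is the number of
edges joining `a` and `b` (the adjacency matrix), which is at most `D - 1`. -/
structure QuditGraph (D n : ℕ) where
  mult : Matrix (Fin n) (Fin n) ℕ
  symm : ∀ a b, mult a b = mult b a
  loopless : ∀ a, mult a a = 0
  mult_lt : ∀ a b, mult a b < D

/-- The controlled-phase gate `CP_{ab} = ∑_{j,k} ω ^ (j k) |j⟩⟨j|_a ⊗ |k⟩⟨k|_b`. -/
def controlledPhase {D n : ℕ} [NeZero D] (a b : Fin n) : Op D n :=
  Matrix.diagonal fun j => omegaPow (j a * j b)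

theorem controlledPhase_pow_commute {D n : ℕ} [NeZero D] (a b c d : Fin n) (s t : ℕ) :
    Commute ((controlledPhase a b : Op D n) ^ s) (controlledPhase c d ^ t) := by
  refine Commute.pow_pow ?_ s t
  simp only [controlledPhase]
  exact Matrix.commute_diagonal _ _

/-- The entangling unitary `U = ∏ CP_{ab} ^ Γ_{ab}`, each pair of vertices occurring once. -/
def entangler {D n : ℕ} [NeZero D] (Γ : QuditGraph D n) : Op D n :=
  (Finset.univ.filter fun p : Fin n × Fin n => p.1 < p.2).noncommProd
    (fun p => controlledPhase p.1 p.2 ^ Γ.mult p.1 p.2)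
    fun p _ q _ _ => controlledPhase_pow_commute p.1 p.2 q.1 q.2 _ _

/-- `|+⟩ ⊗ ⋯ ⊗ |+⟩`, where `|+⟩ = D ^ (-1/2) ∑ⱼ |j⟩`. -/
def plusState (D n : ℕ) : Idx D n → ℂ := fun _ => ∏ _v : Fin n, ((Real.sqrt D : ℝ) : ℂ)⁻¹

/-- The graph state `|G⟩ = U |+⟩^{⊗ n}`. -/
def graphState {D n : ℕ} [NeZero D] (Γ : QuditGraph D n) : Idx D n → ℂ :=
  entangler Γ *ᵥ plusState D n

/-- `Z ^ c = Z₁^{c₁} ⊗ ⋯ ⊗ Zₙ^{cₙ}`. -/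
def zProduct {D n : ℕ} [NeZero D] (c : Idx D n) : UOp D n := pauliUnitary 0 0 c

/-- The codeword `Z ^ c |G⟩`. -/
def codeword {D n : ℕ} [NeZero D] (Γ : QuditGraph D n) (c : Idx D n) : Idx D n → ℂ :=
  (zProduct c : Op D n) *ᵥ graphState Γ

/-- The coding space: the span of the codewords `Z ^ c |G⟩`, `c ∈ C`. -/
def codeSpace {D n : ℕ} [NeZero D] (Γ : QuditGraph D n) (C : AddSubgroup (Idx D n)) :
    Submodule ℂ (EuclideanSpace ℂ (Idx D n)) :=
  Submodule.span ℂ ((fun c => WithLp.toLp 2 (codeword Γ c)) '' (C : Set (Idx D n)))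

/-- The orthogonal projector onto the coding space, as a matrix. -/
def codeProjector {D n : ℕ} [NeZero D] (Γ : QuditGraph D n) (C : AddSubgroup (Idx D n)) :
    Op D n :=
  (Matrix.toEuclideanCLM (𝕜 := ℂ) (n := Idx D n)).symm (codeSpace Γ C).starProjection

/-- The coding group: the operators `Z ^ c`, `c ∈ C`. -/
def codingGroup {D n : ℕ} [NeZero D] (C : AddSubgroup (Idx D n)) : Subgroup (UOp D n) where
  carrier := zProduct '' (C : Set (Idx D n))
  one_mem' := ⟨0, zero_mem C, Subtype.ext pauliProduct_zero⟩
  mul_mem' := by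
    rintro _ _ ⟨c, hc, rfl⟩ ⟨d, hd, rfl⟩
    refine ⟨c + d, add_mem hc hd, Subtype.ext ?_⟩
    refine Eq.trans ?_ (pauliProduct_mul 0 0 0 c 0 d).symm
    simp [zProduct, pauliUnitary]
  inv_mem' := by
    rintro _ ⟨c, hc, rfl⟩
    refine ⟨-c, neg_mem hc, Subtype.ext ?_⟩
    refine Eq.trans ?_ (star_pauliProduct 0 0 c).symm
    simp [zProduct, pauliUnitary]

/-- The stabilizer `S` of the code: the Pauli products that fix every codeword. -/
def codeStabilizer {D n : ℕ} [NeZero D] (Γ : QuditGraph D n) (C : AddSubgroup (Idx D n)) :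
    Subgroup (UOp D n) :=
  pauliStabilizer (codeword Γ '' (C : Set (Idx D n)))

/-- The stabilizer of the graph state in the Pauli group. -/
def graphStabilizer {D n : ℕ} [NeZero D] (Γ : QuditGraph D n) : Subgroup (UOp D n) :=
  pauliStabilizer {graphState Γ}

/-- The group `W` generated by the stabilizer of the graph state and the coding group. -/
def groupW {D n : ℕ} [NeZero D] (Γ : QuditGraph D n) (C : AddSubgroup (Idx D n)) :
    Subgroup (UOp D n) :=
  graphStabilizer Γ ⊔ codingGroup C

instance {D n : ℕ} [NeZero D] (Γ : QuditGraph D n) (C : AddSubgroup (Idx D n)) :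
    Finite (codeStabilizer Γ C) := by
  unfold codeStabilizer
  infer_instance

/-- The information operator `ĝ = |S|⁻¹ ∑_{s ∈ S} g s` of the coset `g S`. -/
def infoOp {D n : ℕ} [NeZero D] (Γ : QuditGraph D n) (C : AddSubgroup (Idx D n))
    (g : UOp D n) : Op D n :=
  (Nat.card (codeStabilizer Γ C) : ℂ)⁻¹ • ∑ᶠ s : codeStabilizer Γ C, (g : Op D n) * (s : UOp D n)

/-- The (underlying set of the) information group: the operators `ĝ`, `g ∈ W`. -/
def infoGroup {D n : ℕ} [NeZero D] (Γ : QuditGraph D n) (C : AddSubgroup (Idx D n)) :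
    Set (Op D n) :=
  infoOp Γ C '' (groupW Γ C : Set (UOp D n))

/-! ### Subsets of carriers -/

/-- Basis labels of the qudits in `B`. -/
abbrev IdxOn (D : ℕ) {n : ℕ} (B : Finset (Fin n)) : Type := {v : Fin n // v ∈ B} → ZMod D

/-- Basis labels of the qudits outside `B`. -/
abbrev IdxOff (D : ℕ) {n : ℕ} (B : Finset (Fin n)) : Type := {v : Fin n // v ∉ B} → ZMod D

/-- Splitting a basis label into its part in `B` and its part outside `B`. -/
def splitIdx (D : ℕ) {n : ℕ} (B : Finset (Fin n)) : Idx D n ≃ IdxOn D B × IdxOff D B :=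
  Equiv.piEquivPiSubtypeProd (fun v => v ∈ B) fun _ => ZMod D

/-- The partial trace over the qudits outside `B`. -/
def ptrace {D n : ℕ} [NeZero D] (B : Finset (Fin n)) (A : Op D n) :
    Matrix (IdxOn D B) (IdxOn D B) ℂ :=
  Matrix.of fun i j => ∑ k : IdxOff D B, A ((splitIdx D B).symm (i, k)) ((splitIdx D B).symm (j, k))

/-- `A` is based in `B`: it is an operator on the qudits in `B`, tensored with the identity. -/
def IsBasedIn {D n : ℕ} (B : Finset (Fin n)) (A : Op D n) : Prop :=
  ∃ A' : Matrix (IdxOn D B) (IdxOn D B) ℂ,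
    A = (A' ⊗ₖ (1 : Matrix (IdxOff D B) (IdxOff D B) ℂ)).submatrix (splitIdx D B) (splitIdx D B)

/-- The constant `N = |S ∩ ℬ| D ^ |Bᶜ| / |S|`, where `ℬ` is the set of operators based in `B`. -/
def normConst {D n : ℕ} [NeZero D] (Γ : QuditGraph D n) (C : AddSubgroup (Idx D n))
    (B : Finset (Fin n)) : ℝ :=
  (Nat.card {s : UOp D n // s ∈ codeStabilizer Γ C ∧ IsBasedIn B (s : Op D n)} : ℝ) *
    (D : ℝ) ^ Bᶜ.card / (Nat.card (codeStabilizer Γ C) : ℝ)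

/-- The normalized partial trace `A ↦ N⁻¹ Tr_{Bᶜ} A`. -/
def reduced {D n : ℕ} [NeZero D] (Γ : QuditGraph D n) (C : AddSubgroup (Idx D n))
    (B : Finset (Fin n)) (A : Op D n) : Matrix (IdxOn D B) (IdxOn D B) ℂ :=
  (normConst Γ C B : ℂ)⁻¹ • ptrace B A

/-- The information operators whose partial trace down to `B` is nonzero. -/
def subsetInfo {D n : ℕ} [NeZero D] (Γ : QuditGraph D n) (C : AddSubgroup (Idx D n))
    (B : Finset (Fin n)) : Set (Op D n) :=
  {A | A ∈ infoGroup Γ C ∧ ptrace B A ≠ 0}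

/-- The nonzero operators on the qudits in `B` of the form `N⁻¹ Tr_{Bᶜ} ĝ`, with `ĝ` an
information operator. -/
def reducedInfo {D n : ℕ} [NeZero D] (Γ : QuditGraph D n) (C : AddSubgroup (Idx D n))
    (B : Finset (Fin n)) : Set (Matrix (IdxOn D B) (IdxOn D B) ℂ) :=
  {A | A ≠ 0 ∧ ∃ g ∈ infoGroup Γ C, A = reduced Γ C B g}

end

end AdditiveGraphCode

open AdditiveGraphCode

namespace AdditiveGraphCode

/-! ### Pauli products: entries, commutation, inverses -/

/-! The hinge is that the code projector `P` is the average of the stabilizer `S`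
(`groupAverage_codeStabilizer`). That average is a projector fixing every codeword, and its trace is
`D^n / |S|`, since nonidentity elements of the graph stabilizer are traceless. The codewords are
characters times a nowhere vanishing vector, so the code has dimension `K`. Solving `x ⬝ c = 0` on
`C` yields enough stabilizer elements for `D^n ≤ |S| K`. Hence the two projectors have equal rank
and coincide.

Every information operator is therefore `g P` with `g ∈ W`. Since `W` normalizes `S`, each `g`
commutes with `P`, and information operators multiply as their representatives do.

A Pauli operator has nonzero partial trace only if it is based in `B`
(`isBasedIn_of_ptrace_ne_zero`). Two things follow. An operator survives the partial trace exactly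
when its coset has a representative `U ⊗ I` (`mem_subsetInfo_iff`), and it then reduces to `U P_B`.
Moreover `P_B ⊗ I` is the average of the elements of `S` based in `B`, so `P_B` is a projector, and
it commutes with each such `U`. Thus `(U P_B)(V P_B) = U V P_B`, which is multiplicativity. For
injectivity, `U P_B = V P_B` forces the two representatives to differ by an element of `S`, by a
trace argument (`reduced_injOn`). -/

theorem omegaPow_ne_zero {D : ℕ} [NeZero D] (a : ZMod D) : omegaPow a ≠ 0 := by
  intro h
  have := omegaPow_add a (-a)
  simp [h, omegaPow_zero] at this

theorem pauliProduct_mulVec {D n : ℕ} [NeZero D] (l : ZMod D) (x z : Idx D n) (v : Idx D n → ℂ)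
    (j : Idx D n) :
    (pauliProduct l x z *ᵥ v) j = omegaPow (l + ∑ a, (j + x) a * z a) * v (j + x) := by
  rw [Matrix.mulVec, dotProduct, Finset.sum_eq_single (j + x)]
  · simp [pauliProduct_apply]
  · intro b _ hb
    simp [pauliProduct_apply, hb]
  · simp

/-- Two Pauli operators commute up to a scalar. -/
theorem exists_smul_mul_comm {D n : ℕ} [NeZero D] {p q : UOp D n} (hp : p ∈ pauliGroup D n)
    (hq : q ∈ pauliGroup D n) :
    ∃ c : ℂ, (p : Op D n) * (q : Op D n) = c • ((q : Op D n) * (p : Op D n)) := by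
  obtain ⟨l, x, z, rfl⟩ := hp
  obtain ⟨l', x', z', rfl⟩ := hq
  refine ⟨omegaPow ((∑ v, x v * z' v) - ∑ v, x' v * z v), ?_⟩
  simp only [pauliUnitary, pauliProduct_mul]
  ext j k
  simp only [Matrix.smul_apply, pauliProduct_apply, smul_eq_mul, mul_ite, mul_zero,
    ← omegaPow_add, add_comm x' x]
  congr 2
  simp only [add_comm z' z]
  ring

theorem codingGroup_le_pauliGroup {D n : ℕ} [NeZero D] (C : AddSubgroup (Idx D n)) :
    codingGroup C ≤ pauliGroup D n := by
  rintro _ ⟨c, -, rfl⟩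
  exact ⟨0, 0, c, rfl⟩

theorem groupW_le_pauliGroup {D n : ℕ} [NeZero D] (Γ : QuditGraph D n)
    (C : AddSubgroup (Idx D n)) : groupW Γ C ≤ pauliGroup D n :=
  sup_le (fun _ h => h.1) (codingGroup_le_pauliGroup C)

theorem codeStabilizer_le_graphStabilizer {D n : ℕ} [NeZero D] (Γ : QuditGraph D n)
    (C : AddSubgroup (Idx D n)) : codeStabilizer Γ C ≤ graphStabilizer Γ := by
  rintro s ⟨hs, hs'⟩
  refine ⟨hs, ?_⟩
  rintro _ rfl
  have := hs' _ ⟨0, zero_mem C, rfl⟩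
  simpa [codeword, zProduct, pauliUnitary, pauliProduct_zero] using this

theorem codeStabilizer_le_groupW {D n : ℕ} [NeZero D] (Γ : QuditGraph D n)
    (C : AddSubgroup (Idx D n)) : codeStabilizer Γ C ≤ groupW Γ C :=
  (codeStabilizer_le_graphStabilizer Γ C).trans le_sup_left

/-! ### The graph state -/

/-- The phase exponent of the graph state: `∑_{a < b} Γ_{ab} j_a j_b`. -/
def graphPhase {D n : ℕ} (Γ : QuditGraph D n) (j : Idx D n) : ZMod D :=
  ∑ p : Fin n × Fin n with p.1 < p.2, j p.1 * j p.2 * (Γ.mult p.1 p.2 : ZMod D)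

theorem entangler_eq_diagonal {D n : ℕ} [NeZero D] (Γ : QuditGraph D n) :
    entangler Γ = Matrix.diagonal fun j => omegaPow (graphPhase Γ j) := by
  -- The product is computed in the commutative ring of functions and carried to matrices by the
  -- diagonal embedding.
  have h := Finset.map_noncommProd (Finset.univ.filter fun p : Fin n × Fin n => p.1 < p.2)
    (fun p (j : Idx D n) => omegaPow (j p.1 * j p.2 * (Γ.mult p.1 p.2 : ZMod D)))
    (fun _ _ _ _ _ => Commute.all _ _) (Matrix.diagonalRingHom (Idx D n) ℂ)
  rw [Finset.noncommProd_eq_prod] at h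
  have h2 : (fun j => omegaPow (graphPhase Γ j)) = ∏ p : Fin n × Fin n with p.1 < p.2,
      fun j : Idx D n => omegaPow (j p.1 * j p.2 * (Γ.mult p.1 p.2 : ZMod D)) := by
    ext j
    rw [Finset.prod_apply, graphPhase, omegaPow_sum]
  rw [h2]
  refine Eq.trans ?_ h.symm
  refine Finset.noncommProd_congr rfl (fun p _ => ?_) _
  simp only [controlledPhase, Matrix.diagonal_pow, Matrix.diagonalRingHom_apply]
  congr 1
  ext j
  simp [omegaPow_pow]

theorem exists_graphState_apply {D n : ℕ} [NeZero D] (Γ : QuditGraph D n) :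
    ∃ a : ℂ, a ≠ 0 ∧ ∀ j, graphState Γ j = omegaPow (graphPhase Γ j) * a := by
  refine ⟨∏ _v : Fin n, ((Real.sqrt D : ℝ) : ℂ)⁻¹, ?_, fun j => ?_⟩
  · have : (0 : ℝ) < D := Nat.cast_pos.2 (NeZero.pos D)
    exact Finset.prod_ne_zero_iff.2 fun _ _ =>
      inv_ne_zero (Complex.ofReal_ne_zero.2 (Real.sqrt_pos.2 this).ne')
  · rw [graphState, entangler_eq_diagonal, Matrix.mulVec_diagonal]
    rfl

/-- Translating the phase exponent of a graph state changes it by an affine function. -/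
theorem exists_graphPhase_add {D n : ℕ} (Γ : QuditGraph D n) (x : Idx D n) :
    ∃ (z : Idx D n) (l : ZMod D), ∀ j,
      graphPhase Γ (j + x) = graphPhase Γ j + ∑ v, j v * z v + l := by
  unfold graphPhase
  -- Each edge contributes separately, so the induction runs over an arbitrary finite set of pairs.
  generalize (Finset.univ.filter fun p : Fin n × Fin n => p.1 < p.2) = s
  induction s using Finset.induction_on with
  | empty => exact ⟨0, 0, by simp⟩
  | insert p s hp ih =>
    obtain ⟨z, l, h⟩ := ih
    -- These are the cross terms and the constant term of `(j_a + x_a)(j_b + x_b) Γ_ab`.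
    refine ⟨z + (Pi.single p.1 (x p.2 * (Γ.mult p.1 p.2 : ZMod D)) +
      Pi.single p.2 (x p.1 * (Γ.mult p.1 p.2 : ZMod D))),
      l + x p.1 * x p.2 * (Γ.mult p.1 p.2 : ZMod D), fun j => ?_⟩
    rw [Finset.sum_insert hp, Finset.sum_insert hp, h]
    simp only [Pi.add_apply, mul_add, Finset.sum_add_distrib, Pi.single_apply, mul_ite, mul_zero,
      Finset.sum_ite_eq', Finset.mem_univ, if_true]
    ring

theorem codeword_apply {D n : ℕ} [NeZero D] (Γ : QuditGraph D n) (c j : Idx D n) :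
    codeword Γ c j = omegaPow (∑ v, j v * c v) * graphState Γ j := by
  simp [codeword, zProduct, pauliUnitary, pauliProduct_mulVec]

/-- For every `x` there is a Pauli product with `X`-part `x` that fixes the graph state and
multiplies each codeword `Z ^ c |G⟩` by a phase. -/
theorem exists_pauliProduct_mulVec_codeword {D n : ℕ} [NeZero D] (Γ : QuditGraph D n)
    (x : Idx D n) : ∃ (l : ZMod D) (z : Idx D n), ∀ c,
      pauliProduct l x z *ᵥ codeword Γ c = omegaPow (∑ v, x v * c v) • codeword Γ c := by
  obtain ⟨a, -, hG⟩ := exists_graphState_apply Γ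
  obtain ⟨z, l, h⟩ := exists_graphPhase_add Γ x
  -- The `Z`-part `-z` cancels the linear term produced by the translation, and the scalar absorbs
  -- `l` and the leftover `x ⬝ z`. What remains is the shift of `ω^(j ⬝ c)` under `j ↦ j + x`.
  refine ⟨-l + ∑ v, x v * z v, -z, fun c => ?_⟩
  ext j
  rw [pauliProduct_mulVec, codeword_apply, Pi.smul_apply, codeword_apply, hG, hG, h, smul_eq_mul]
  simp only [← mul_assoc, ← omegaPow_add]
  congr 2
  simp only [Pi.add_apply, Pi.neg_apply, add_mul, mul_neg, Finset.sum_add_distrib,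
    Finset.sum_neg_distrib]
  ring

/-! ### Dimension of the code and order of its stabilizer -/

/-- The character `j ↦ ω ^ (j ⬝ c)`. -/
noncomputable def dotChar {D n : ℕ} [NeZero D] (c : Idx D n) : AddChar (Idx D n) ℂ where
  toFun j := omegaPow (∑ v, j v * c v)
  map_zero_eq_one' := by simp [omegaPow_zero]
  map_add_eq_mul' i j := by simp [add_mul, Finset.sum_add_distrib, omegaPow_add]

theorem dotChar_apply {D n : ℕ} [NeZero D] (c j : Idx D n) :
    dotChar c j = omegaPow (∑ v, j v * c v) := rfl

theorem dotChar_injective {D n : ℕ} [NeZero D] :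
    Function.Injective (dotChar : Idx D n → AddChar (Idx D n) ℂ) := by
  intro c d h
  ext v
  have := DFunLike.congr_fun h (Pi.single v 1)
  simp only [dotChar_apply, Pi.single_apply, ite_mul, one_mul, zero_mul, Finset.sum_ite_eq',
    Finset.mem_univ, if_true] at this
  exact ZMod.injective_stdAddChar this

theorem graphState_ne_zero {D n : ℕ} [NeZero D] (Γ : QuditGraph D n) (j : Idx D n) :
    graphState Γ j ≠ 0 := by
  obtain ⟨a, ha, hG⟩ := exists_graphState_apply Γ
  rw [hG]
  exact mul_ne_zero (omegaPow_ne_zero _) ha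

/-- Codewords are pairwise distinct characters multiplied by a vector without zero entries, so
Dedekind's independence of characters applies. -/
theorem linearIndependent_codeword {D n : ℕ} [NeZero D] (Γ : QuditGraph D n) :
    LinearIndependent ℂ fun c : Idx D n => WithLp.toLp 2 (codeword Γ c) := by
  have h := (AddChar.linearIndependent (Idx D n) ℂ).comp _ (dotChar_injective (D := D) (n := n))
  let T : (Idx D n → ℂ) →ₗ[ℂ] EuclideanSpace ℂ (Idx D n) :=
    (WithLp.linearEquiv 2 ℂ (Idx D n → ℂ)).symm.toLinearMap ∘ₗ
      LinearMap.mulRight ℂ (graphState Γ)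
  have hT : LinearMap.ker T = ⊥ := by
    rw [LinearMap.ker_eq_bot']
    intro f hf
    ext j
    have := congrArg (fun w : EuclideanSpace ℂ (Idx D n) => w j) hf
    simpa [T, graphState_ne_zero] using this
  have hc : (fun c : Idx D n => WithLp.toLp 2 (codeword Γ c)) =
      T ∘ (DFunLike.coe ∘ dotChar) := by
    ext c j
    simp [T, codeword_apply, dotChar_apply]
  rw [hc]
  exact h.map' T hT

theorem finrank_codeSpace {D n : ℕ} [NeZero D] (Γ : QuditGraph D n) (C : AddSubgroup (Idx D n)) :
    Module.finrank ℂ (codeSpace Γ C) = Nat.card C := by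
  classical
  have h := (linearIndependent_codeword Γ).comp (Subtype.val : C → Idx D n)
    Subtype.val_injective
  have hs : codeSpace Γ C = Submodule.span ℂ (Set.range
      ((fun c => WithLp.toLp 2 (codeword Γ c)) ∘ (Subtype.val : C → Idx D n))) := by
    rw [codeSpace, Set.range_comp, Subtype.range_coe]
  rw [Nat.card_eq_fintype_card, ← finrank_span_eq_card h, hs]

theorem exists_mem_codeStabilizer {D n : ℕ} [NeZero D] (Γ : QuditGraph D n)
    (C : AddSubgroup (Idx D n)) {x : Idx D n} (hx : ∀ c ∈ C, ∑ v, x v * c v = 0) :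
    ∃ (l : ZMod D) (z : Idx D n), pauliUnitary l x z ∈ codeStabilizer Γ C := by
  obtain ⟨l, z, h⟩ := exists_pauliProduct_mulVec_codeword Γ x
  refine ⟨l, z, ⟨l, x, z, rfl⟩, ?_⟩
  rintro _ ⟨c, hc, rfl⟩
  refine (h c).trans ?_
  rw [hx c hc, omegaPow_zero, one_smul]

/-- The only nonzero entry in row `0` of a Pauli product lies in column `x`. -/
theorem pauliUnitary_xpart_injective {D n : ℕ} [NeZero D] {l l' : ZMod D} {x x' z z' : Idx D n}
    (h : pauliUnitary l x z = pauliUnitary l' x' z') : x = x' := by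
  have := congrFun (congrFun (congrArg Subtype.val h) 0) x
  simp only [pauliUnitary, pauliProduct_apply, zero_add, if_true] at this
  by_contra hne
  rw [if_neg hne] at this
  exact omegaPow_ne_zero _ this

/-- The characters of `C` induced by the elements of `ℤ_D ^ n`. -/
noncomputable def dotCharHom {D n : ℕ} [NeZero D] (C : AddSubgroup (Idx D n)) :
    Idx D n →+ AddChar C ℂ where
  toFun x := (dotChar x).compAddMonoidHom C.subtype
  map_zero' := by
    ext c
    simp [dotChar_apply, omegaPow_zero]
  map_add' x y := by
    ext c
    simp [dotChar_apply, omegaPow_add, mul_add, Finset.sum_add_distrib]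

/-- The vectors annihilating `C` form the kernel of `dotCharHom` and inject into the stabilizer
through their `X`-parts; the range has at most `|C|` characters. The opposite inequality is not
needed, because a rank cannot be negative. -/
theorem card_le_card_codeStabilizer_mul {D n : ℕ} [NeZero D] (Γ : QuditGraph D n)
    (C : AddSubgroup (Idx D n)) :
    Nat.card (Idx D n) ≤ Nat.card (codeStabilizer Γ C) * Nat.card C := by
  have hker : ∀ x : (dotCharHom C).ker, ∃ (l : ZMod D) (z : Idx D n),
      pauliUnitary l x.1 z ∈ codeStabilizer Γ C := by
    intro x
    refine exists_mem_codeStabilizer Γ C fun c hc => ?_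
    have := DFunLike.congr_fun (AddMonoidHom.mem_ker.1 x.2) ⟨c, hc⟩
    have h2 : omegaPow (∑ v, c v * x.1 v) = omegaPow (0 : ZMod D) := by
      rw [omegaPow_zero]
      exact this
    rw [← ZMod.injective_stdAddChar h2]
    simp only [mul_comm]
  choose l z h using hker
  have h1 : Nat.card (dotCharHom C).ker ≤ Nat.card (codeStabilizer Γ C) :=
    Nat.card_le_card_of_injective (fun x => ⟨_, h x⟩) fun x y hxy =>
      Subtype.ext (pauliUnitary_xpart_injective (congrArg Subtype.val hxy))
  have h2 : Nat.card (dotCharHom C).range ≤ Nat.card C := by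
    classical
    have : Nat.card (AddChar C ℂ) = Nat.card C := by
      rw [Nat.card_eq_fintype_card, Nat.card_eq_fintype_card, AddChar.card_eq]
    rw [← this]
    exact Nat.card_le_card_of_injective _ Subtype.val_injective
  rw [← AddSubgroup.card_mul_index (dotCharHom C).ker, AddSubgroup.index_ker]
  exact Nat.mul_le_mul h1 h2

/-! ### Idempotent matrices and averages over finite groups of unitaries -/

theorem trace_eq_rank_of_isIdempotentElem {m : Type*} [Fintype m] [DecidableEq m]
    {A : Matrix m m ℂ} (h : IsIdempotentElem A) : A.trace = A.rank := by
  have h' : IsIdempotentElem (Matrix.toLin' A) := by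
    rw [IsIdempotentElem, Module.End.mul_eq_comp, ← Matrix.toLin'_mul, h.eq]
  have := (LinearMap.IsIdempotentElem.isProj_range _ h').trace
  rwa [Matrix.trace_toLin'_eq] at this

/-- The average of the elements of a finite group of unitary matrices. -/
noncomputable def groupAverage {m : Type*} [Fintype m] [DecidableEq m]
    (H : Subgroup (Matrix.unitaryGroup m ℂ)) : Matrix m m ℂ :=
  (Nat.card H : ℂ)⁻¹ • ∑ᶠ s : H, ((s : Matrix.unitaryGroup m ℂ) : Matrix m m ℂ)

section GroupAverage

variable {m : Type*} [Fintype m] [DecidableEq m] (H : Subgroup (Matrix.unitaryGroup m ℂ))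

theorem groupAverage_eq_sum [Fintype H] : groupAverage H =
    (Nat.card H : ℂ)⁻¹ • ∑ s : H, ((s : Matrix.unitaryGroup m ℂ) : Matrix m m ℂ) := by
  rw [groupAverage, finsum_eq_sum_of_fintype]

variable [Finite H]

/-- Left translation by `g` permutes `H`. -/
theorem mul_groupAverage {g : Matrix.unitaryGroup m ℂ} (hg : g ∈ H) :
    (g : Matrix m m ℂ) * groupAverage H = groupAverage H := by
  have := Fintype.ofFinite H
  rw [groupAverage_eq_sum, Matrix.mul_smul, Finset.mul_sum]
  congr 1
  exact Fintype.sum_equiv (Equiv.mulLeft (⟨g, hg⟩ : H)) _ _ fun s => rfl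

theorem mul_groupAverage_comm_of_mem_normalizer {g : Matrix.unitaryGroup m ℂ}
    (hg : g ∈ Subgroup.normalizer (H : Set (Matrix.unitaryGroup m ℂ))) :
    (g : Matrix m m ℂ) * groupAverage H = groupAverage H * (g : Matrix m m ℂ) := by
  have := Fintype.ofFinite H
  rw [groupAverage_eq_sum, Matrix.mul_smul, Matrix.smul_mul, Finset.mul_sum, Finset.sum_mul]
  congr 1
  refine Fintype.sum_bijective
    (fun s : H => (⟨g * s * g⁻¹, (Subgroup.mem_normalizer_iff.1 hg _).1 s.2⟩ : H)) ?_ _ _ ?_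
  · rw [Fintype.bijective_iff_injective_and_card]
    refine ⟨fun s t h => Subtype.ext ?_, rfl⟩
    simpa using congrArg Subtype.val h
  · intro s
    rw [← Submonoid.coe_mul, ← Submonoid.coe_mul]
    simp

/-- Idempotence comes from translation invariance; self-adjointness from inversion permuting `H`, as
the adjoint of a unitary is its inverse. -/
theorem isStarProjection_groupAverage : IsStarProjection (groupAverage H) := by
  have := Fintype.ofFinite H
  have hc : (Nat.card H : ℂ) ≠ 0 := Nat.cast_ne_zero.2 Nat.card_pos.ne'
  constructor
  · have : (∑ s : H, ((s : Matrix.unitaryGroup m ℂ) : Matrix m m ℂ)) * groupAverage H =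
        (Nat.card H : ℂ) • groupAverage H := by
      rw [Finset.sum_mul, Finset.sum_congr rfl fun s _ => mul_groupAverage H s.2]
      simp [Nat.card_eq_fintype_card, ← Nat.cast_smul_eq_nsmul ℂ]
    rw [IsIdempotentElem]
    conv_lhs => rw [groupAverage_eq_sum, Matrix.smul_mul, ← groupAverage_eq_sum, this]
    rw [inv_smul_smul₀ hc]
  · rw [IsSelfAdjoint, groupAverage_eq_sum, star_smul, star_sum]
    congr 1
    · simp
    · exact Fintype.sum_equiv (Equiv.inv H) _ _ fun s => rfl

theorem trace_groupAverage
    (h : ∀ s : H, s ≠ 1 → ((s : Matrix.unitaryGroup m ℂ) : Matrix m m ℂ).trace = 0) :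
    (groupAverage H).trace = Fintype.card m / Nat.card H := by
  have := Fintype.ofFinite H
  rw [groupAverage_eq_sum, Matrix.trace_smul, Matrix.trace_sum, Finset.sum_eq_single 1]
  · simp [div_eq_inv_mul]
  · intro s _ hs
    exact h s hs
  · simp

end GroupAverage

/-! ### Operators based in a set of carriers and partial traces -/

section Based

variable {D n : ℕ} [NeZero D] (B : Finset (Fin n))

/-- The extension `A ↦ A ⊗ I` of operators on the qudits in `B` to all the qudits. -/
noncomputable def liftOp : Matrix (IdxOn D B) (IdxOn D B) ℂ →ₐ[ℂ] Op D n where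
  toFun A := (A ⊗ₖ (1 : Matrix (IdxOff D B) (IdxOff D B) ℂ)).submatrix
    (splitIdx D B) (splitIdx D B)
  map_one' := by simp
  map_mul' A A' := by
    rw [Matrix.submatrix_mul_equiv, ← Matrix.mul_kronecker_mul, mul_one]
  map_zero' := by simp
  map_add' A A' := by
    rw [Matrix.add_kronecker]
    rfl
  commutes' r := by
    rw [Algebra.algebraMap_eq_smul_one, Algebra.algebraMap_eq_smul_one, Matrix.smul_kronecker,
      Matrix.one_kronecker_one]
    ext i j
    simp [Matrix.one_apply]

theorem liftOp_apply (A : Matrix (IdxOn D B) (IdxOn D B) ℂ) (i j : Idx D n) :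
    liftOp B A i j = A (splitIdx D B i).1 (splitIdx D B j).1 *
      (1 : Matrix (IdxOff D B) (IdxOff D B) ℂ) (splitIdx D B i).2 (splitIdx D B j).2 := rfl

theorem star_liftOp (A : Matrix (IdxOn D B) (IdxOn D B) ℂ) :
    star (liftOp B A) = liftOp B (star A) := by
  ext i j
  simp only [Matrix.star_apply, liftOp_apply, star_mul', Matrix.one_apply, eq_comm]
  split_ifs <;> simp

theorem ptrace_apply (A : Op D n) (i j : IdxOn D B) : ptrace B A i j =
    ∑ k : IdxOff D B, A ((splitIdx D B).symm (i, k)) ((splitIdx D B).symm (j, k)) := rfl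

theorem ptrace_smul (c : ℂ) (A : Op D n) : ptrace B (c • A) = c • ptrace B A := by
  ext i j
  simp [ptrace_apply, Finset.mul_sum]

theorem ptrace_sum {ι : Type*} (s : Finset ι) (A : ι → Op D n) :
    ptrace B (∑ t ∈ s, A t) = ∑ t ∈ s, ptrace B (A t) := by
  ext i j
  simp only [ptrace_apply, Matrix.sum_apply]
  exact Finset.sum_comm

theorem trace_ptrace (A : Op D n) : (ptrace B A).trace = A.trace := by
  simp only [Matrix.trace, Matrix.diag, ptrace_apply]
  rw [← (splitIdx D B).symm.sum_comp, Fintype.sum_prod_type]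

theorem liftOp_mul_apply (A : Matrix (IdxOn D B) (IdxOn D B) ℂ) (M : Op D n) (i : IdxOn D B)
    (k : IdxOff D B) (y : Idx D n) : (liftOp B A * M) ((splitIdx D B).symm (i, k)) y =
      ∑ a, A i a * M ((splitIdx D B).symm (a, k)) y := by
  rw [Matrix.mul_apply, ← (splitIdx D B).symm.sum_comp, Fintype.sum_prod_type]
  refine Finset.sum_congr rfl fun a _ => ?_
  simp [liftOp_apply, Matrix.one_apply]

theorem mul_liftOp_apply (A : Matrix (IdxOn D B) (IdxOn D B) ℂ) (M : Op D n) (i : IdxOn D B)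
    (k : IdxOff D B) (y : Idx D n) : (M * liftOp B A) y ((splitIdx D B).symm (i, k)) =
      ∑ a, M y ((splitIdx D B).symm (a, k)) * A a i := by
  rw [Matrix.mul_apply, ← (splitIdx D B).symm.sum_comp, Fintype.sum_prod_type]
  refine Finset.sum_congr rfl fun a _ => ?_
  simp [liftOp_apply, Matrix.one_apply]

theorem ptrace_liftOp_mul (A : Matrix (IdxOn D B) (IdxOn D B) ℂ) (M : Op D n) :
    ptrace B (liftOp B A * M) = A * ptrace B M := by
  ext i j
  rw [ptrace_apply, Matrix.mul_apply]
  simp only [ptrace_apply, Finset.mul_sum]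
  rw [Finset.sum_comm]
  exact Finset.sum_congr rfl fun k _ => liftOp_mul_apply B A M i k _

theorem ptrace_mul_liftOp (A : Matrix (IdxOn D B) (IdxOn D B) ℂ) (M : Op D n) :
    ptrace B (M * liftOp B A) = ptrace B M * A := by
  ext i j
  rw [ptrace_apply, Matrix.mul_apply]
  simp only [ptrace_apply, Finset.sum_mul]
  rw [Finset.sum_comm]
  exact Finset.sum_congr rfl fun k _ => mul_liftOp_apply B A M j k _

theorem ptrace_one : ptrace B (1 : Op D n) = ((D : ℂ) ^ Bᶜ.card) • 1 := by
  ext i j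
  have : Fintype.card {v // v ∉ B} = Bᶜ.card := by
    rw [Fintype.card_subtype]
    congr 1
    ext v
    simp
  simp [ptrace_apply, Matrix.one_apply, ZMod.card, this]

theorem ptrace_liftOp (A : Matrix (IdxOn D B) (IdxOn D B) ℂ) :
    ptrace B (liftOp B A) = ((D : ℂ) ^ Bᶜ.card) • A := by
  rw [← mul_one (liftOp B A), ptrace_liftOp_mul, ptrace_one, Matrix.mul_smul, mul_one]

theorem liftOp_injective : Function.Injective (liftOp (D := D) B) := by
  intro A A' h
  have := congrArg (ptrace B) h
  rw [ptrace_liftOp, ptrace_liftOp] at this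
  exact smul_right_injective _ (pow_ne_zero _ (Nat.cast_ne_zero.2 (NeZero.ne D))) this

/-- The group of unitaries based in `B`. -/
def basedSubgroup : Subgroup (UOp D n) where
  carrier := {u | IsBasedIn B (u : Op D n)}
  one_mem' := ⟨1, (map_one (liftOp B)).symm⟩
  mul_mem' := by
    rintro u v ⟨U, hU⟩ ⟨V, hV⟩
    exact ⟨U * V, (congrArg₂ (· * ·) hU hV).trans (map_mul (liftOp B) U V).symm⟩
  inv_mem' := by
    rintro u ⟨U, hU⟩
    exact ⟨star U, (congrArg star hU).trans (star_liftOp B U)⟩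

theorem mem_basedSubgroup {u : UOp D n} :
    u ∈ basedSubgroup B ↔ ∃ A, (u : Op D n) = liftOp B A := Iff.rfl

/-- A Pauli operator with nonzero partial trace is based in `B`. -/
theorem isBasedIn_of_ptrace_ne_zero {p : UOp D n} (hp : p ∈ pauliGroup D n)
    (h : ptrace B (p : Op D n) ≠ 0) : p ∈ basedSubgroup B := by
  obtain ⟨l, x, z, rfl⟩ := hp
  have hx : ∀ v ∉ B, x v = 0 := by
    intro v hv
    by_contra hne
    -- A nonzero `X`-part at `v ∉ B` moves the label at `v`, so no entry with equal outer labels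
    -- survives.
    refine h (Matrix.ext fun i j => Finset.sum_eq_zero fun k _ => ?_)
    simp only [pauliUnitary, pauliProduct_apply]
    rw [if_neg]
    intro he
    have := congrFun he v
    simp [splitIdx, hv] at this
    exact hne this
  -- Once `x` vanishes off `B`, entries factor into a part on `B` and a diagonal part off `B`.
  have hentry : ∀ (i j : IdxOn D B) (k k' : IdxOff D B),
      pauliProduct l x z ((splitIdx D B).symm (i, k)) ((splitIdx D B).symm (j, k')) =
        (if ∀ v, j v = i v + x v then omegaPow (l + ∑ v, j v * z v) else 0) *
          (if k = k' then omegaPow (∑ v, k' v * z v) else 0) := by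
    intro i j k k'
    have hiff : (splitIdx D B).symm (j, k') = (splitIdx D B).symm (i, k) + x ↔
        (∀ v, j v = i v + x v) ∧ k = k' := by
      constructor
      · intro he
        refine ⟨fun v => ?_, funext fun v => ?_⟩
        · simpa [splitIdx, v.2] using congrFun he v
        · simpa [splitIdx, v.2, hx _ v.2, eq_comm] using congrFun he v
      · rintro ⟨hj, rfl⟩
        ext v
        by_cases hv : v ∈ B
        · simpa [splitIdx, hv] using hj ⟨v, hv⟩
        · simp [splitIdx, hv, hx v hv]
    have hsum : ∑ v, (splitIdx D B).symm (j, k') v * z v =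
        ∑ v, j v * z v + ∑ v, k' v * z v := by
      rw [← Fintype.sum_subtype_add_sum_subtype (fun v => v ∈ B)]
      congr 1
      · exact Finset.sum_congr (by ext; simp) fun v _ => by simp [splitIdx, v.2]
      · exact Finset.sum_congr (by ext; simp) fun v _ => by simp [splitIdx, v.2]
    rw [pauliProduct_apply, hsum, ← add_assoc, omegaPow_add]
    simp only [hiff]
    split_ifs <;> simp_all
  have hz : ∀ v ∉ B, z v = 0 := by
    intro v hv
    by_contra hne
    have hzero : ∑ k : IdxOff D B, omegaPow (∑ v, k v * z v) = 0 := by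
      -- A nontrivial character sums to zero: shifting `k` by the unit vector at `v` multiplies the
      -- sum by `ω^(z v) ≠ 1`.
      have hshift := Equiv.sum_comp
        (Equiv.addRight (Pi.single (⟨v, hv⟩ : {v // v ∉ B}) (1 : ZMod D) : IdxOff D B))
        fun k : IdxOff D B => omegaPow (∑ v, k v * z v)
      simp only [Equiv.coe_addRight, Pi.add_apply, add_mul, Finset.sum_add_distrib, omegaPow_add,
        ← Finset.sum_mul, Pi.single_apply, ite_mul, one_mul, zero_mul, Finset.sum_ite_eq',
        Finset.mem_univ, if_true] at hshift
      exact (mul_right_eq_self₀.1 hshift).resolve_left fun h1 =>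
        hne (ZMod.injective_stdAddChar (h1.trans omegaPow_zero.symm))
    refine h (Matrix.ext fun i j => ?_)
    rw [ptrace_apply]
    simp only [pauliUnitary, hentry, if_true, ← Finset.mul_sum, hzero, mul_zero,
      Matrix.zero_apply]
  refine (mem_basedSubgroup B).2 ⟨Matrix.of fun i j =>
    if ∀ v, j v = i v + x v then omegaPow (l + ∑ v, j v * z v) else 0, ?_⟩
  ext i j
  obtain ⟨⟨i, k⟩, rfl⟩ := (splitIdx D B).symm.surjective i
  obtain ⟨⟨j, k'⟩, rfl⟩ := (splitIdx D B).symm.surjective j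
  have hk : ∑ v : {v // v ∉ B}, k' v * z v = 0 :=
    Finset.sum_eq_zero fun v _ => by rw [hz _ v.2, mul_zero]
  simp only [pauliUnitary, hentry, liftOp_apply, Equiv.apply_symm_apply, hk, omegaPow_zero,
    Matrix.one_apply, Matrix.of_apply]

/-- This is the case `B = ∅` of the previous result: the trace is the partial trace onto no qudits,
and operators based in `∅` are scalars. -/
theorem exists_eq_smul_one_of_trace_ne_zero {p : UOp D n} (hp : p ∈ pauliGroup D n)
    (h : (p : Op D n).trace ≠ 0) : ∃ c : ℂ, (p : Op D n) = c • 1 := by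
  have h' : ptrace ∅ (p : Op D n) ≠ 0 := by
    intro h0
    rw [← trace_ptrace ∅, h0, Matrix.trace_zero] at h
    exact h rfl
  obtain ⟨A, hA⟩ := isBasedIn_of_ptrace_ne_zero ∅ hp h'
  refine ⟨A default default, ?_⟩
  rw [hA]
  have : A = A default default • 1 := by
    ext i j
    simp [Subsingleton.elim i default, Subsingleton.elim j default]
  change liftOp ∅ A = _
  conv_lhs => rw [this]
  rw [map_smul, map_one]

end Based

/-! ### The code projector and the information operators -/

section Code

variable {D n : ℕ} [NeZero D] (Γ : QuditGraph D n) (C : AddSubgroup (Idx D n))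

theorem infoOp_eq_mul_groupAverage (g : UOp D n) :
    infoOp Γ C g = (g : Op D n) * groupAverage (codeStabilizer Γ C) := by
  have := Fintype.ofFinite (codeStabilizer Γ C)
  rw [infoOp, groupAverage_eq_sum, finsum_eq_sum_of_fintype, Matrix.mul_smul, Finset.mul_sum]

theorem graphStabilizer_smul_one {p : UOp D n} (hp : p ∈ graphStabilizer Γ) {c : ℂ}
    (h : (p : Op D n) = c • 1) : c = 1 := by
  have := congrFun (hp.2 _ rfl) 0
  rw [h, Matrix.smul_mulVec, Matrix.one_mulVec, Pi.smul_apply, smul_eq_mul] at this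
  exact (mul_left_eq_self₀.1 this).resolve_right (graphState_ne_zero Γ 0)

theorem trace_graphStabilizer {p : UOp D n} (hp : p ∈ graphStabilizer Γ) (h1 : p ≠ 1) :
    (p : Op D n).trace = 0 := by
  by_contra h
  obtain ⟨c, hc⟩ := exists_eq_smul_one_of_trace_ne_zero hp.1 h
  refine h1 (Subtype.ext ?_)
  rw [hc, graphStabilizer_smul_one Γ hp hc, one_smul]
  rfl

theorem trace_groupAverage_of_le {H : Subgroup (UOp D n)} [Finite H]
    (hH : H ≤ graphStabilizer Γ) :
    (groupAverage H).trace = Fintype.card (Idx D n) / Nat.card H :=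
  trace_groupAverage H fun s hs => trace_graphStabilizer Γ (hH s.2) fun h => hs (Subtype.ext h)

theorem trace_codeProjector : (codeProjector Γ C).trace = Nat.card C := by
  have h : Matrix.toEuclideanLin (codeProjector Γ C) =
      (codeSpace Γ C).starProjection.toLinearMap := by
    rw [← Matrix.coe_toEuclideanCLM_eq_toEuclideanLin, codeProjector,
      StarAlgEquiv.apply_symm_apply]
  have hp : LinearMap.IsProj (codeSpace Γ C) (codeSpace Γ C).starProjection.toLinearMap :=
    ⟨fun x => Submodule.starProjection_apply_mem _ x,
      fun x hx => Submodule.starProjection_eq_self_iff.2 hx⟩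
  have := hp.trace
  rw [finrank_codeSpace, ← h, Matrix.toEuclideanLin, Matrix.toLpLin_eq_toLin,
    Matrix.trace_toLin_eq] at this
  exact this

theorem isStarProjection_codeProjector : IsStarProjection (codeProjector Γ C) := by
  have h := isStarProjection_starProjection (U := codeSpace Γ C)
  exact ⟨(map_mul (Matrix.toEuclideanCLM (𝕜 := ℂ) (n := Idx D n)).symm _ _).symm.trans
    (congrArg _ h.isIdempotentElem.eq),
    (map_star (Matrix.toEuclideanCLM (𝕜 := ℂ) (n := Idx D n)).symm _).symm.trans
    (congrArg _ h.isSelfAdjoint.star_eq)⟩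

/-- Stabilizer elements fix the codewords, so their average fixes the whole span, which is the range
of the projector. -/
theorem groupAverage_mul_codeProjector :
    groupAverage (codeStabilizer Γ C) * codeProjector Γ C = codeProjector Γ C := by
  have hfix : ∀ v ∈ codeSpace Γ C, Matrix.toEuclideanCLM (𝕜 := ℂ) (n := Idx D n)
      (groupAverage (codeStabilizer Γ C)) v = v := by
    intro v hv
    induction hv using Submodule.span_induction with
    | mem v hv =>
      obtain ⟨c, hc, rfl⟩ := hv
      have := Fintype.ofFinite (codeStabilizer Γ C)
      rw [Matrix.toEuclideanCLM_toLp, groupAverage_eq_sum, Matrix.smul_mulVec,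
        Matrix.sum_mulVec, Finset.sum_congr rfl fun s _ => s.2.2 _ ⟨c, hc, rfl⟩]
      simp [Nat.card_eq_fintype_card, ← Nat.cast_smul_eq_nsmul ℂ]
    | zero => simp
    | add v w _ _ hv hw => rw [map_add, hv, hw]
    | smul a v _ hv => rw [map_smul, hv]
  refine (Matrix.toEuclideanCLM (𝕜 := ℂ) (n := Idx D n)).injective ?_
  change Matrix.toEuclideanCLM (𝕜 := ℂ) (n := Idx D n) _ = Matrix.toEuclideanCLM (𝕜 := ℂ) _
  rw [map_mul, codeProjector, StarAlgEquiv.apply_symm_apply]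
  ext1 v
  exact hfix _ (Submodule.starProjection_apply_mem _ v)

/-- The difference of the two projectors is idempotent because one absorbs the other. Its trace is
thus its rank, and counting shows that this is zero. -/
theorem groupAverage_codeStabilizer :
    groupAverage (codeStabilizer Γ C) = codeProjector Γ C := by
  have h1 := groupAverage_mul_codeProjector Γ C
  have hP := isStarProjection_groupAverage (codeStabilizer Γ C)
  have hQ := isStarProjection_codeProjector Γ C
  have h2 := congrArg star h1
  rw [star_mul, hP.isSelfAdjoint.star_eq, hQ.isSelfAdjoint.star_eq] at h2
  have hi : IsIdempotentElem (groupAverage (codeStabilizer Γ C) - codeProjector Γ C) := by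
    rw [IsIdempotentElem, sub_mul, mul_sub, mul_sub, h1, h2, hP.isIdempotentElem.eq,
      hQ.isIdempotentElem.eq, sub_self, sub_zero]
  have ht := trace_eq_rank_of_isIdempotentElem hi
  rw [Matrix.trace_sub, trace_codeProjector,
    trace_groupAverage_of_le Γ (codeStabilizer_le_graphStabilizer Γ C)] at ht
  have hle := card_le_card_codeStabilizer_mul Γ C
  rw [Nat.card_eq_fintype_card (α := Idx D n)] at hle
  have hS : 0 < Nat.card (codeStabilizer Γ C) := Nat.card_pos
  have hS' : (Nat.card (codeStabilizer Γ C) : ℂ) ≠ 0 := Nat.cast_ne_zero.2 hS.ne'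
  rw [sub_eq_iff_eq_add, div_eq_iff hS'] at ht
  norm_cast at ht
  -- Here `ht` reads `D^n = (rank + K) |S|`, while `D^n ≤ |S| K` and `|S| > 0`.
  have hr : (groupAverage (codeStabilizer Γ C) - codeProjector Γ C).rank = 0 := by
    nlinarith
  rw [Matrix.rank, Submodule.finrank_eq_zero, LinearMap.range_eq_bot] at hr
  exact sub_eq_zero.1 (Matrix.toLin'.injective (hr.trans (map_zero Matrix.toLin').symm))

theorem infoOp_eq (g : UOp D n) : infoOp Γ C g = (g : Op D n) * codeProjector Γ C := by
  rw [infoOp_eq_mul_groupAverage, groupAverage_codeStabilizer]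

theorem mul_codeProjector_of_mem {s : UOp D n} (hs : s ∈ codeStabilizer Γ C) :
    (s : Op D n) * codeProjector Γ C = codeProjector Γ C := by
  rw [← groupAverage_codeStabilizer]
  exact mul_groupAverage _ hs

/-- A Pauli operator whose inverse permutes the codewords up to phases normalizes the code
stabilizer. -/
theorem conj_mem_codeStabilizer {g s : UOp D n} (hg : g ∈ pauliGroup D n)
    (h : ∀ c ∈ C, ∃ (a : ℂ), ∃ d ∈ C,
      ((g⁻¹ : UOp D n) : Op D n) *ᵥ codeword Γ c = a • codeword Γ d)
    (hs : s ∈ codeStabilizer Γ C) : g * s * g⁻¹ ∈ codeStabilizer Γ C := by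
  refine ⟨mul_mem (mul_mem hg hs.1) (inv_mem hg), ?_⟩
  rintro _ ⟨c, hc, rfl⟩
  obtain ⟨a, d, hd, h⟩ := h c hc
  rw [Submonoid.coe_mul, Submonoid.coe_mul, ← Matrix.mulVec_mulVec, ← Matrix.mulVec_mulVec, h,
    Matrix.mulVec_smul, hs.2 _ ⟨d, hd, rfl⟩, ← h, Matrix.mulVec_mulVec, ← Submonoid.coe_mul,
    mul_inv_cancel]
  simp

/-- It suffices to treat the two generating subgroups: the graph stabilizer multiplies each codeword
by a scalar, since Pauli operators commute up to scalars, and the coding group permutes the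
codewords. -/
theorem groupW_le_normalizer : groupW Γ C ≤
    Subgroup.normalizer (codeStabilizer Γ C : Set (UOp D n)) := by
  have key : ∀ K : Subgroup (UOp D n), (∀ g ∈ K, ∀ s ∈ codeStabilizer Γ C,
      g * s * g⁻¹ ∈ codeStabilizer Γ C) →
      K ≤ Subgroup.normalizer (codeStabilizer Γ C : Set (UOp D n)) := by
    intro K hK g hg
    rw [Subgroup.mem_normalizer_iff]
    refine fun s => ⟨hK g hg s, fun h => ?_⟩
    simpa [mul_assoc] using hK _ (inv_mem hg) _ h
  refine sup_le (key _ fun g hg s hs => ?_) (key _ fun g hg s hs => ?_)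
  · refine conj_mem_codeStabilizer Γ C hg.1 (fun c hc => ?_) hs
    obtain ⟨a, ha⟩ := exists_smul_mul_comm (inv_mem hg).1
      (codingGroup_le_pauliGroup C ⟨c, hc, rfl⟩)
    refine ⟨a, c, hc, ?_⟩
    rw [codeword, Matrix.mulVec_mulVec, ha, Matrix.smul_mulVec, ← Matrix.mulVec_mulVec,
      (inv_mem hg).2 _ rfl]
  · refine conj_mem_codeStabilizer Γ C (codingGroup_le_pauliGroup C hg) (fun c hc => ?_) hs
    obtain ⟨d, hd, hgd⟩ := inv_mem hg
    refine ⟨1, c + d, add_mem hc hd, ?_⟩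
    rw [← hgd]
    ext j
    simp [zProduct, pauliUnitary, pauliProduct_mulVec, codeword_apply, mul_add,
      Finset.sum_add_distrib, omegaPow_add]
    ring

theorem mul_codeProjector_comm {g : UOp D n} (hg : g ∈ groupW Γ C) :
    (g : Op D n) * codeProjector Γ C = codeProjector Γ C * (g : Op D n) := by
  rw [← groupAverage_codeStabilizer]
  exact mul_groupAverage_comm_of_mem_normalizer _ (groupW_le_normalizer Γ C hg)

theorem infoOp_mul {g h : UOp D n} (hh : h ∈ groupW Γ C) :
    infoOp Γ C g * infoOp Γ C h = infoOp Γ C (g * h) := by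
  simp only [infoOp_eq, Submonoid.coe_mul]
  rw [mul_assoc (g : Op D n), ← mul_assoc (codeProjector Γ C), ← mul_codeProjector_comm Γ C hh,
    mul_assoc (h : Op D n), (isStarProjection_codeProjector Γ C).isIdempotentElem.eq, mul_assoc]

theorem infoOp_one : infoOp Γ C 1 = codeProjector Γ C := by
  rw [infoOp_eq, Submonoid.coe_one, one_mul]

end Code

/-! ### Reduced information operators -/

section Reduced

variable {D n : ℕ} [NeZero D] (Γ : QuditGraph D n) (C : AddSubgroup (Idx D n))
  (B : Finset (Fin n))

instance : Finite (codeStabilizer Γ C ⊓ basedSubgroup B : Subgroup (UOp D n)) :=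
  Finite.of_injective _ (Subgroup.inclusion_injective inf_le_left)

theorem normConst_pos : 0 < normConst Γ C B := by
  have h : 0 < Nat.card (codeStabilizer Γ C ⊓ basedSubgroup B : Subgroup (UOp D n)) :=
    Nat.card_pos
  have hD : (0 : ℝ) < D := Nat.cast_pos.2 (NeZero.pos D)
  exact div_pos (mul_pos (Nat.cast_pos.2 h) (pow_pos hD _)) (Nat.cast_pos.2 Nat.card_pos)

theorem normConst_ne_zero : (normConst Γ C B : ℂ) ≠ 0 :=
  Complex.ofReal_ne_zero.2 (normConst_pos Γ C B).ne'

theorem reduced_ne_zero_iff {A : Op D n} : reduced Γ C B A ≠ 0 ↔ ptrace B A ≠ 0 := by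
  rw [reduced, smul_ne_zero_iff]
  exact and_iff_right (inv_ne_zero (normConst_ne_zero Γ C B))

theorem reduced_liftOp_mul (U : Matrix (IdxOn D B) (IdxOn D B) ℂ) (M : Op D n) :
    reduced Γ C B (liftOp B U * M) = U * reduced Γ C B M := by
  rw [reduced, ptrace_liftOp_mul, reduced, Matrix.mul_smul]

theorem reduced_mul_liftOp (U : Matrix (IdxOn D B) (IdxOn D B) ℂ) (M : Op D n) :
    reduced Γ C B (M * liftOp B U) = reduced Γ C B M * U := by
  rw [reduced, ptrace_mul_liftOp, reduced, Matrix.smul_mul]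

/-- The reduced code projector is the average of the stabilizer elements based in `B`. -/
theorem liftOp_reduced_codeProjector : liftOp B (reduced Γ C B (codeProjector Γ C)) =
    groupAverage (codeStabilizer Γ C ⊓ basedSubgroup B) := by
  have := Fintype.ofFinite (codeStabilizer Γ C)
  have := Fintype.ofFinite (codeStabilizer Γ C ⊓ basedSubgroup B : Subgroup (UOp D n))
  -- Elements of `S` not based in `B` have zero partial trace, and those based in `B` return as
  -- themselves times `D^|Bᶜ|`. The constant `N` is what turns the remaining sum into an average.
  have hsum : ∑ s : (codeStabilizer Γ C ⊓ basedSubgroup B : Subgroup (UOp D n)),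
      (D : ℂ) ^ Bᶜ.card • ((s : UOp D n) : Op D n) =
      ∑ s : codeStabilizer Γ C, liftOp B (ptrace B ((s : UOp D n) : Op D n)) := by
    refine Fintype.sum_of_injective (Subgroup.inclusion inf_le_left)
      (Subgroup.inclusion_injective _) _ _ (fun s hs => ?_) fun s => ?_
    · by_contra h
      refine hs ⟨⟨s, s.2, isBasedIn_of_ptrace_ne_zero B s.2.1 fun h0 => h ?_⟩, rfl⟩
      rw [h0, map_zero]
    · obtain ⟨U, hU⟩ := (mem_basedSubgroup B).1 s.2.2
      change _ = liftOp B (ptrace B ((s : UOp D n) : Op D n))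
      rw [hU, ptrace_liftOp, map_smul]
  have hcard : Nat.card {s : UOp D n // s ∈ codeStabilizer Γ C ∧ IsBasedIn B (s : Op D n)} =
      Nat.card (codeStabilizer Γ C ⊓ basedSubgroup B : Subgroup (UOp D n)) := rfl
  have h1 : (Nat.card (codeStabilizer Γ C ⊓ basedSubgroup B : Subgroup (UOp D n)) : ℂ) ≠ 0 :=
    Nat.cast_ne_zero.2 Nat.card_pos.ne'
  have h2 : (Nat.card (codeStabilizer Γ C) : ℂ) ≠ 0 := Nat.cast_ne_zero.2 Nat.card_pos.ne'
  have h3 : (D : ℂ) ≠ 0 := Nat.cast_ne_zero.2 (NeZero.ne D)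
  rw [← groupAverage_codeStabilizer, groupAverage_eq_sum, groupAverage_eq_sum, reduced,
    ptrace_smul, ptrace_sum, map_smul, map_smul, map_sum, ← hsum, ← Finset.smul_sum, smul_smul,
    smul_smul, normConst, hcard]
  congr 1
  push_cast
  field_simp

theorem isStarProjection_reduced_codeProjector :
    IsStarProjection (reduced Γ C B (codeProjector Γ C)) := by
  have h := isStarProjection_groupAverage (codeStabilizer Γ C ⊓ basedSubgroup B)
  rw [← liftOp_reduced_codeProjector] at h
  constructor
  · apply liftOp_injective B
    rw [map_mul, h.isIdempotentElem.eq]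
  · apply liftOp_injective B
    rw [← star_liftOp, h.isSelfAdjoint.star_eq]

theorem trace_reduced (A : Op D n) :
    (reduced Γ C B A).trace = A.trace / (normConst Γ C B : ℂ) := by
  rw [reduced, Matrix.trace_smul, trace_ptrace, smul_eq_mul, div_eq_inv_mul]

theorem trace_reduced_codeProjector_ne_zero :
    (reduced Γ C B (codeProjector Γ C)).trace ≠ 0 := by
  rw [trace_reduced, trace_codeProjector]
  exact div_ne_zero (Nat.cast_ne_zero.2 Nat.card_pos.ne') (normConst_ne_zero Γ C B)

theorem mul_reduced_codeProjector_comm {g : UOp D n} (hg : g ∈ groupW Γ C)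
    {U : Matrix (IdxOn D B) (IdxOn D B) ℂ} (hU : (g : Op D n) = liftOp B U) :
    U * reduced Γ C B (codeProjector Γ C) = reduced Γ C B (codeProjector Γ C) * U := by
  rw [← reduced_liftOp_mul, ← reduced_mul_liftOp, ← hU, mul_codeProjector_comm Γ C hg]

/-- The reduction is `U P_B` with `U` invertible and `P_B` of nonzero trace. -/
theorem ptrace_infoOp_ne_zero {g : UOp D n} (hg : g ∈ basedSubgroup B) :
    ptrace B (infoOp Γ C g) ≠ 0 := by
  obtain ⟨U, hU⟩ := (mem_basedSubgroup B).1 hg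
  obtain ⟨V, hV⟩ := (mem_basedSubgroup B).1 (inv_mem hg)
  have hVU : V * U = 1 := by
    apply liftOp_injective B
    rw [map_mul, ← hU, ← hV, ← Submonoid.coe_mul, inv_mul_cancel, map_one, Submonoid.coe_one]
  rw [← reduced_ne_zero_iff Γ C, infoOp_eq, hU, reduced_liftOp_mul]
  intro h
  apply trace_reduced_codeProjector_ne_zero Γ C B
  rw [← one_mul (reduced Γ C B (codeProjector Γ C)), ← hVU, mul_assoc, h, mul_zero,
    Matrix.trace_zero]

/-- An information operator has nonzero partial trace iff its coset has a representative based
in `B`. -/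
theorem mem_subsetInfo_iff {A : Op D n} :
    A ∈ subsetInfo Γ C B ↔ ∃ g ∈ groupW Γ C ⊓ basedSubgroup B, infoOp Γ C g = A := by
  constructor
  · rintro ⟨⟨g, hg, rfl⟩, h⟩
    have := Fintype.ofFinite (codeStabilizer Γ C)
    rw [infoOp, finsum_eq_sum_of_fintype, ptrace_smul, ptrace_sum] at h
    -- Some term `g s` of the coset sum has nonzero partial trace; it is the representative based in
    -- `B`.
    obtain ⟨s, -, hs⟩ := Finset.exists_ne_zero_of_sum_ne_zero (smul_ne_zero_iff.1 h).2
    have hgs : g * s ∈ groupW Γ C := mul_mem hg (codeStabilizer_le_groupW Γ C s.2)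
    refine ⟨g * s, ⟨hgs, isBasedIn_of_ptrace_ne_zero B (groupW_le_pauliGroup Γ C hgs) hs⟩, ?_⟩
    rw [infoOp_eq, infoOp_eq, Submonoid.coe_mul, mul_assoc, mul_codeProjector_of_mem Γ C s.2]
  · rintro ⟨g, ⟨hg, hg'⟩, rfl⟩
    exact ⟨⟨g, hg, rfl⟩, ptrace_infoOp_ne_zero Γ C B hg'⟩

theorem mem_reducedInfo_iff {A : Matrix (IdxOn D B) (IdxOn D B) ℂ} :
    A ∈ reducedInfo Γ C B ↔ ∃ M ∈ subsetInfo Γ C B, reduced Γ C B M = A := by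
  constructor
  · rintro ⟨h, M, hM, rfl⟩
    exact ⟨M, ⟨hM, (reduced_ne_zero_iff Γ C B).1 h⟩, rfl⟩
  · rintro ⟨M, ⟨hM, h⟩, rfl⟩
    exact ⟨(reduced_ne_zero_iff Γ C B).2 h, M, hM, rfl⟩

/-- With representatives `U` and `V` based in `B`, both sides equal `U V P_B`, by commuting `V` past
the idempotent `P_B`. -/
theorem reduced_mul {M M' : Op D n} (h : M ∈ subsetInfo Γ C B) (h' : M' ∈ subsetInfo Γ C B) :
    reduced Γ C B (M * M') = reduced Γ C B M * reduced Γ C B M' := by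
  obtain ⟨g, ⟨hg, hg'⟩, rfl⟩ := (mem_subsetInfo_iff Γ C B).1 h
  obtain ⟨k, ⟨hk, hk'⟩, rfl⟩ := (mem_subsetInfo_iff Γ C B).1 h'
  obtain ⟨U, hU⟩ := (mem_basedSubgroup B).1 hg'
  obtain ⟨V, hV⟩ := (mem_basedSubgroup B).1 hk'
  rw [infoOp_mul Γ C hk, infoOp_eq, infoOp_eq, infoOp_eq, Submonoid.coe_mul, hU, hV, ← map_mul,
    reduced_liftOp_mul, reduced_liftOp_mul, reduced_liftOp_mul, mul_assoc U, mul_assoc U,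
    mul_reduced_codeProjector_comm Γ C B hk hV,
    ← mul_assoc (reduced Γ C B (codeProjector Γ C)) _ V,
    (isStarProjection_reduced_codeProjector Γ C B).isIdempotentElem.eq]

theorem reduced_injOn : Set.InjOn (reduced Γ C B) (subsetInfo Γ C B) := by
  intro M h M' h' heq
  obtain ⟨g, ⟨hg, hg'⟩, rfl⟩ := (mem_subsetInfo_iff Γ C B).1 h
  obtain ⟨k, ⟨hk, hk'⟩, rfl⟩ := (mem_subsetInfo_iff Γ C B).1 h'
  have := Fintype.ofFinite (codeStabilizer Γ C ⊓ basedSubgroup B : Subgroup (UOp D n))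
  have hlift : (g : Op D n) * groupAverage (codeStabilizer Γ C ⊓ basedSubgroup B) =
      (k : Op D n) * groupAverage (codeStabilizer Γ C ⊓ basedSubgroup B) := by
    obtain ⟨U, hU⟩ := (mem_basedSubgroup B).1 hg'
    obtain ⟨V, hV⟩ := (mem_basedSubgroup B).1 hk'
    rw [← liftOp_reduced_codeProjector, hU, hV, ← map_mul, ← map_mul, ← reduced_liftOp_mul,
      ← reduced_liftOp_mul, ← hU, ← hV, ← infoOp_eq, ← infoOp_eq, heq]
  have hq : ((k⁻¹ * g : UOp D n) : Op D n) *
      groupAverage (codeStabilizer Γ C ⊓ basedSubgroup B) =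
      groupAverage (codeStabilizer Γ C ⊓ basedSubgroup B) := by
    rw [Submonoid.coe_mul, mul_assoc, hlift, ← mul_assoc, ← Submonoid.coe_mul, inv_mul_cancel,
      Submonoid.coe_one, one_mul]
  have hne : (groupAverage (codeStabilizer Γ C ⊓ basedSubgroup B)).trace ≠ 0 := by
    rw [trace_groupAverage_of_le Γ
      (inf_le_left.trans (codeStabilizer_le_graphStabilizer Γ C))]
    exact div_ne_zero (Nat.cast_ne_zero.2 Fintype.card_ne_zero)
      (Nat.cast_ne_zero.2 Nat.card_pos.ne')
  -- The average is unchanged by `k⁻¹ g` and has nonzero trace, so some term `k⁻¹ g s` has nonzero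
  -- trace and is therefore a scalar.
  have hex : ∃ s : (codeStabilizer Γ C ⊓ basedSubgroup B : Subgroup (UOp D n)),
      ((k⁻¹ * g * s : UOp D n) : Op D n).trace ≠ 0 := by
    by_contra! hall
    apply hne
    rw [← hq]
    conv_lhs => rw [groupAverage_eq_sum, Matrix.mul_smul, Finset.mul_sum, Matrix.trace_smul,
      Matrix.trace_sum]
    exact (congrArg _ (Finset.sum_eq_zero fun s _ => hall s)).trans (smul_zero _)
  obtain ⟨s, hs⟩ := hex
  have hW : k⁻¹ * g * s ∈ groupW Γ C :=
    mul_mem (mul_mem (inv_mem hk) hg) (codeStabilizer_le_groupW Γ C s.2.1)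
  obtain ⟨c, hc⟩ := exists_eq_smul_one_of_trace_ne_zero (groupW_le_pauliGroup Γ C hW) hs
  have hcq : c • groupAverage (codeStabilizer Γ C ⊓ basedSubgroup B) =
      groupAverage (codeStabilizer Γ C ⊓ basedSubgroup B) := by
    conv_lhs => rw [← one_mul (groupAverage _), ← smul_mul_assoc, ← hc, Submonoid.coe_mul,
      mul_assoc, mul_groupAverage _ s.2, hq]
  -- The scalar fixes an operator of nonzero trace, so it is `1`; hence `g` and `k` lie in the same
  -- coset of `S`.
  have hc1 : c = 1 := by
    have := congrArg Matrix.trace hcq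
    rw [Matrix.trace_smul, smul_eq_mul] at this
    exact (mul_left_eq_self₀.1 this).resolve_right hne
  have h1 : k⁻¹ * g * s = 1 := Subtype.ext (by rw [hc, hc1, one_smul]; rfl)
  have hgk : g = k * (s : UOp D n)⁻¹ := by
    rw [eq_mul_inv_iff_mul_eq, ← mul_left_cancel_iff (a := k⁻¹), ← mul_assoc, h1, inv_mul_cancel]
  rw [infoOp_eq, infoOp_eq, hgk, Submonoid.coe_mul, mul_assoc,
    mul_codeProjector_of_mem Γ C (inv_mem s.2.1)]

/-! ### The groups -/

/-- Makes the adjoint the group inverse, both here and, through `star_reduced`, after reduction to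
`B`. -/
theorem star_infoOp {g : UOp D n} (hg : g ∈ groupW Γ C) :
    star (infoOp Γ C g) = infoOp Γ C g⁻¹ := by
  rw [infoOp_eq, infoOp_eq, mul_codeProjector_comm Γ C (inv_mem hg), star_mul,
    (isStarProjection_codeProjector Γ C).isSelfAdjoint.star_eq]
  rfl

theorem star_mem_subsetInfo {M : Op D n} (h : M ∈ subsetInfo Γ C B) :
    star M ∈ subsetInfo Γ C B := by
  obtain ⟨g, hg, rfl⟩ := (mem_subsetInfo_iff Γ C B).1 h
  exact (mem_subsetInfo_iff Γ C B).2 ⟨g⁻¹, inv_mem hg, (star_infoOp Γ C hg.1).symm⟩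

theorem mul_mem_subsetInfo {M M' : Op D n} (h : M ∈ subsetInfo Γ C B)
    (h' : M' ∈ subsetInfo Γ C B) : M * M' ∈ subsetInfo Γ C B := by
  obtain ⟨g, hg, rfl⟩ := (mem_subsetInfo_iff Γ C B).1 h
  obtain ⟨k, hk, rfl⟩ := (mem_subsetInfo_iff Γ C B).1 h'
  exact (mem_subsetInfo_iff Γ C B).2 ⟨g * k, mul_mem hg hk, (infoOp_mul Γ C hk.1).symm⟩

theorem codeProjector_mem_subsetInfo : codeProjector Γ C ∈ subsetInfo Γ C B :=
  (mem_subsetInfo_iff Γ C B).2 ⟨1, one_mem _, infoOp_one Γ C⟩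

theorem codeProjector_mul {M : Op D n} (h : M ∈ infoGroup Γ C) : codeProjector Γ C * M = M := by
  obtain ⟨g, hg, rfl⟩ := h
  rw [← infoOp_one, infoOp_mul Γ C hg, one_mul]

theorem star_mul_self_of_mem_infoGroup {M : Op D n} (h : M ∈ infoGroup Γ C) :
    star M * M = codeProjector Γ C := by
  obtain ⟨g, hg, rfl⟩ := h
  rw [star_infoOp Γ C hg, infoOp_mul Γ C hg, inv_mul_cancel, infoOp_one]

theorem star_reduced (M : Op D n) : star (reduced Γ C B M) = reduced Γ C B (star M) := by
  ext i j
  simp [reduced, ptrace_apply]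

end Reduced

/-- A set closed under multiplication and `star`, in which `star` is a left inverse with respect
to a left identity, is a group. -/
abbrev groupOfStarClosed {R : Type*} [Semigroup R] [Star R] (T : Set R) (e : R) (he : e ∈ T)
    (hmul : ∀ a ∈ T, ∀ b ∈ T, a * b ∈ T) (hstar : ∀ a ∈ T, star a ∈ T)
    (hone : ∀ a ∈ T, e * a = a) (hinv : ∀ a ∈ T, star a * a = e) : Group T :=
  letI : Mul T := ⟨fun a b => ⟨a * b, hmul a a.2 b b.2⟩⟩
  letI : Inv T := ⟨fun a => ⟨star (a : R), hstar a a.2⟩⟩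
  letI : One T := ⟨⟨e, he⟩⟩
  Group.ofLeftAxioms (fun _ _ _ => Subtype.ext (mul_assoc _ _ _))
    (fun a => Subtype.ext (hone a a.2)) (fun a => Subtype.ext (hinv a a.2))

/-- The information group under operator multiplication. -/
noncomputable abbrev infoGroupGroup {D n : ℕ} [NeZero D] (Γ : QuditGraph D n)
    (C : AddSubgroup (Idx D n)) : Group (infoGroup Γ C) :=
  groupOfStarClosed _ (codeProjector Γ C) ⟨1, one_mem _, infoOp_one Γ C⟩
    (by
      rintro _ ⟨g, hg, rfl⟩ _ ⟨h, hh, rfl⟩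
      exact ⟨g * h, mul_mem hg hh, (infoOp_mul Γ C hh).symm⟩)
    (by
      rintro _ ⟨g, hg, rfl⟩
      exact ⟨g⁻¹, inv_mem hg, (star_infoOp Γ C hg).symm⟩)
    (fun _ => codeProjector_mul Γ C) (fun _ => star_mul_self_of_mem_infoGroup Γ C)

/-- The nonzero reduced information operators form a group under operator multiplication. -/
noncomputable abbrev reducedInfoGroup {D n : ℕ} [NeZero D] (Γ : QuditGraph D n)
    (C : AddSubgroup (Idx D n)) (B : Finset (Fin n)) : Group (reducedInfo Γ C B) :=
  groupOfStarClosed _ (reduced Γ C B (codeProjector Γ C))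
    ((mem_reducedInfo_iff Γ C B).2 ⟨_, codeProjector_mem_subsetInfo Γ C B, rfl⟩)
    (by
      intro a ha b hb
      obtain ⟨M, hM, rfl⟩ := (mem_reducedInfo_iff Γ C B).1 ha
      obtain ⟨M', hM', rfl⟩ := (mem_reducedInfo_iff Γ C B).1 hb
      exact (mem_reducedInfo_iff Γ C B).2
        ⟨_, mul_mem_subsetInfo Γ C B hM hM', reduced_mul Γ C B hM hM'⟩)
    (by
      intro a ha
      obtain ⟨M, hM, rfl⟩ := (mem_reducedInfo_iff Γ C B).1 ha
      exact (mem_reducedInfo_iff Γ C B).2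
        ⟨_, star_mem_subsetInfo Γ C B hM, (star_reduced Γ C B M).symm⟩)
    (by
      intro a ha
      obtain ⟨M, hM, rfl⟩ := (mem_reducedInfo_iff Γ C B).1 ha
      rw [← reduced_mul Γ C B (codeProjector_mem_subsetInfo Γ C B) hM, codeProjector_mul Γ C hM.1])
    (by
      intro a ha
      obtain ⟨M, hM, rfl⟩ := (mem_reducedInfo_iff Γ C B).1 ha
      rw [star_reduced, ← reduced_mul Γ C B (star_mem_subsetInfo Γ C B hM) hM,
        star_mul_self_of_mem_infoGroup Γ C hM.1])

theorem exists_reduced_mulEquiv {D n : ℕ} [NeZero D] (Γ : QuditGraph D n)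
    (C : AddSubgroup (Idx D n)) (B : Finset (Fin n)) :
    letI := infoGroupGroup Γ C
    letI := reducedInfoGroup Γ C B
    ∃ H : Subgroup ↥(infoGroup Γ C),
      (∀ a : infoGroup Γ C, a ∈ H ↔ (a : Op D n) ∈ subsetInfo Γ C B) ∧
      ∃ φ : H ≃* ↥(reducedInfo Γ C B), ∀ a : H,
        (φ a : Matrix (IdxOn D B) (IdxOn D B) ℂ) =
          reduced Γ C B ((a : infoGroup Γ C) : Op D n) := by
  let _ := infoGroupGroup Γ C
  let _ := reducedInfoGroup Γ C B
  let H : Subgroup ↥(infoGroup Γ C) :=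
    { carrier := {a | (a : Op D n) ∈ subsetInfo Γ C B}
      one_mem' := codeProjector_mem_subsetInfo Γ C B
      mul_mem' := fun ha hb => mul_mem_subsetInfo Γ C B ha hb
      inv_mem' := fun ha => star_mem_subsetInfo Γ C B ha }
  let φ : H →ₙ* ↥(reducedInfo Γ C B) :=
    { toFun := fun a => ⟨reduced Γ C B ((a : infoGroup Γ C) : Op D n),
        (mem_reducedInfo_iff Γ C B).2 ⟨_, a.2, rfl⟩⟩
      map_mul' := fun a b => Subtype.ext (reduced_mul Γ C B a.2 b.2) }
  have hφ : Function.Bijective φ := by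
    constructor
    · intro a b h
      exact Subtype.ext (Subtype.ext
        (reduced_injOn Γ C B a.2 b.2 (congrArg Subtype.val h)))
    · rintro ⟨A, hA⟩
      obtain ⟨M, hM, rfl⟩ := (mem_reducedInfo_iff Γ C B).1 hA
      exact ⟨⟨⟨M, hM.1⟩, hM⟩, rfl⟩
  exact ⟨H, fun _ => Iff.rfl, MulEquiv.ofBijective φ hφ, fun _ => rfl⟩

end AdditiveGraphCode

theorem mainTheorem10 (D n : ℕ) [NeZero D] (Γ : QuditGraph D n) (C : AddSubgroup (Idx D n))
    (B : Finset (Fin n)) :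
    -- the code has dimension `K = |C|`, and the normalization constant is positive
    Module.finrank ℂ (codeSpace Γ C) = Nat.card C ∧
    0 < normConst Γ C B ∧
    -- the information group and the set of its nonzero normalized partial traces are groups
    -- under operator multiplication, with the (reduced) code projector as the identity
    (∃ (_ : Group ↥(infoGroup Γ C)) (_ : Group ↥(reducedInfo Γ C B)),
      (∀ a b : infoGroup Γ C, ((a * b : infoGroup Γ C) : Op D n) = (a : Op D n) * (b : Op D n)) ∧
      ((1 : infoGroup Γ C) : Op D n) = codeProjector Γ C ∧
      (∀ a b : reducedInfo Γ C B, ((a * b : reducedInfo Γ C B) : Matrix _ _ ℂ) =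
        (a : Matrix (IdxOn D B) (IdxOn D B) ℂ) * (b : Matrix (IdxOn D B) (IdxOn D B) ℂ)) ∧
      ((1 : reducedInfo Γ C B) : Matrix (IdxOn D B) (IdxOn D B) ℂ) =
        reduced Γ C B (codeProjector Γ C) ∧
      -- the operators with nonzero partial trace form a subgroup, and the normalized partial
      -- trace is an isomorphism from it
      ∃ H : Subgroup ↥(infoGroup Γ C),
        (∀ a : infoGroup Γ C, a ∈ H ↔ (a : Op D n) ∈ subsetInfo Γ C B) ∧
        ∃ φ : H ≃* ↥(reducedInfo Γ C B), ∀ a : H,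
          (φ a : Matrix (IdxOn D B) (IdxOn D B) ℂ) = reduced Γ C B ((a : infoGroup Γ C) : Op D n)) ∧
    -- (i)
    (∀ g ∈ subsetInfo Γ C B, ∀ h ∈ subsetInfo Γ C B,
      ptrace B (g * h) = (normConst Γ C B : ℂ)⁻¹ • (ptrace B g * ptrace B h) ∧
      reduced Γ C B (g * h) = reduced Γ C B g * reduced Γ C B h) ∧
    -- (ii)
    (∀ g ∈ subsetInfo Γ C B, ∀ h ∈ subsetInfo Γ C B, g ≠ h →
      reduced Γ C B g ≠ reduced Γ C B h) ∧
    -- (iii)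
    (IsStarProjection (reduced Γ C B (codeProjector Γ C)) ∧
      ((reduced Γ C B (codeProjector Γ C)).rank : ℂ) =
        (codeProjector Γ C).trace / (normConst Γ C B : ℂ) ∧
      ((reduced Γ C B (codeProjector Γ C)).rank : ℝ) =
        (Nat.card C : ℝ) / normConst Γ C B) := by
  refine ⟨finrank_codeSpace Γ C, normConst_pos Γ C B,
    ⟨infoGroupGroup Γ C, reducedInfoGroup Γ C B, fun _ _ => rfl, rfl, fun _ _ => rfl, rfl,
      exists_reduced_mulEquiv Γ C B⟩,
    fun g hg h hh => ⟨?_, reduced_mul Γ C B hg hh⟩,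
    fun g hg h hh hne heq => hne (reduced_injOn Γ C B hg hh heq),
    isStarProjection_reduced_codeProjector Γ C B, ?_, ?_⟩
  -- Multiplying the normalized identity by `N` removes one of its factors `N⁻¹`.
  · have := congrArg (fun A => (normConst Γ C B : ℂ) • A) (reduced_mul Γ C B hg hh)
    simpa only [reduced, Matrix.smul_mul, Matrix.mul_smul,
      smul_inv_smul₀ (normConst_ne_zero Γ C B)] using this
  · rw [← trace_eq_rank_of_isIdempotentElem
      (isStarProjection_reduced_codeProjector Γ C B).isIdempotentElem, trace_reduced]
  · have h := trace_eq_rank_of_isIdempotentElem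
      (isStarProjection_reduced_codeProjector Γ C B).isIdempotentElem
    rw [trace_reduced, trace_codeProjector] at h
    exact_mod_cast h.symm
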